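/- **Corollary.** Let $p=2n+1\equiv 3\pmod 4$ be a prime. Let $K$ be an algebraically closed field of characteristic $0$ (for instance $\mathbb{C}$ or an algebraic closure of $\mathbb{Q}_p$), and let $\widehat{\mathbb{F}_p^\times}$ be the cyclic group of multiplicative characters $\psi:\mathbb{F}_p^\times\to K^\times$, each extended by $\psi(0)=0$. Let $\phi$ be the quadratic character $x\mapsto\left(\frac{x}{p}\right)$, and for characters $\chi,\psi$ let $J_p(\chi,\psi)=\sum_{x\in\mathbb{F}_p}\chi(x)\psi(1-x)$. For a generator $\chi$ of $\widehat{\mathbb{F}_p^\times}$ put $$R_p=R_p(\chi)=\prod_{0<k<(p-1)/4}\left(J_p(\phi,\chi^{k})+J_p(\phi,\chi^{-k})\right),$$ and let $$A_p=\left[\left(\frac{s_i+s_j}{p}\right)\right]_{1\le i,j\le (p-1)/2},$$ where $s_1,\dots,s_{(p-1)/2}$ are the nonzero squares in $\mathbb{F}_p$; this is an integer matrix. Then $-2^{n-1}\det A_p\ge 0$, the number $\sqrt{-2^{n-1}\det A_p}$ is an integer, there is exactly one $\delta_p\in\{1,-1\}$ such that $$\left(\frac{-2\,\delta_p\sqrt{-2^{n-1}\det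 A_p}}{p}\right)=1,$$ and for this $\delta_p$ and every generator $\chi$ of $\widehat{\mathbb{F}_p^\times}$, $$R_p=\delta_p\cdot\sqrt{-2^{n-1}\det A_p}.$$ -/

import Mathlib

/-- The quadratic multiplicative character `φ_q` of the finite field `F`, with values in `K`. -/
def quadChar (F : Type*) [Field F] [Fintype F] [DecidableEq F] (K : Type*) [Field K] :
    MulChar F K :=
  (quadraticChar F).ringHomComp (Int.castRingHom K)

/-- `R_q(χ) = ∏_{0 < k < (q-1)/4} (J_q(φ_q, χ^k) + J_q(φ_q, χ^{-k}))`, where `q = #F`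
and `J_q` is the Jacobi sum. The real inequality `k < (q-1)/4` is written `4 * k < q - 1`. -/
noncomputable def jacobiProduct {F : Type*} [Field F] [Fintype F] [DecidableEq F] {K : Type*} [Field K]
    (χ : MulChar F K) : K :=
  ∏ k ∈ (Finset.range (Fintype.card F)).filter (fun k => 0 < k ∧ 4 * k < Fintype.card F - 1),
    (jacobiSum (quadChar F K) (χ ^ k) + jacobiSum (quadChar F K) (χ ^ k)⁻¹)

/-- The set `S_q` of nonzero squares of `F`, as a type. -/
abbrev NonzeroSquares (F : Type*) [Field F] : Type _ := {s : F // s ≠ 0 ∧ IsSquare s}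

/-- The integer matrix `A_q = [φ_q(s + t)]`, rows and columns indexed by the nonzero squares
`s`, `t` of `F`. (The determinant does not depend on an enumeration of the index set.) -/
def squareSumMatrix (F : Type*) [Field F] [Fintype F] [DecidableEq F] :
    Matrix (NonzeroSquares F) (NonzeroSquares F) ℤ :=
  Matrix.of fun s t => quadraticChar F ((s : F) + (t : F))

/-! Write p = 4m + 3, n = 2m + 1, N = 2n, and j(ψ) = J(φ, ψ) + J(φ, ψ⁻¹). Restricted to the nonzero
squares, a character ψ with ψ^n = 1 is an eigenvector of 2A with eigenvalue j(ψ). For η of order n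
this gives 2^n det A = ∏_{k<n} j(η^k), and since j(1) = -2 and j(ψ⁻¹) = j(ψ), the right side is
-2(∏_{1≤k≤m} j(η^k))². Because j(φψ) = -j(ψ), taking η = χφ yields R² = -2^(n-1) det A
(`sq_prod_jacobiPair_generator`).

The product over η runs over the pairs {ψ, ψ⁻¹} of nontrivial characters with ψ^n = 1, so R does not
depend on χ. It is therefore Galois-invariant, and being an algebraic integer it is a rational
integer r; the square root is |r|.

For the sign, map ℤ[X]/Φ_N to 𝔽_p by sending X to a generator g. Then χ becomes the identity
character and j(χ^k) becomes the binomial coefficient C(2n-k, n). Wilson's theorem and a relation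
between quarter sums of Legendre symbols give (-2r/p) = 1, and (-1/p) = -1 makes this determine the
sign of r. -/

section CharacterSums

/-! ### Jacobi sums with the quadratic character -/

variable (F : Type*) [Field F] [Fintype F] [DecidableEq F] (R : Type*) [CommRing R]

/-- The quadratic character of `F`, with values in a commutative ring. -/
def quadraticCharIn : MulChar F R := (quadraticChar F).ringHomComp (Int.castRingHom R)

variable {F R}

theorem quadraticCharIn_apply (x : F) : quadraticCharIn F R x = (quadraticChar F x : R) := rfl

theorem quadraticCharIn_ringHomComp {R' : Type*} [CommRing R'] (f : R →+* R') :
    (quadraticCharIn F R).ringHomComp f = quadraticCharIn F R' := by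
  ext x
  simp [quadraticCharIn_apply]

theorem quadraticCharIn_mul_self : quadraticCharIn F R * quadraticCharIn F R = 1 := by
  ext x
  simp only [MulChar.mul_apply, quadraticCharIn_apply, MulChar.one_apply_coe]
  rw [← Int.cast_mul, ← sq, quadraticChar_sq_one x.ne_zero, Int.cast_one]

theorem quadraticCharIn_inv : (quadraticCharIn F R)⁻¹ = quadraticCharIn F R :=
  inv_eq_of_mul_eq_one_left quadraticCharIn_mul_self

omit [DecidableEq F] in
theorem ringChar_ne_two_of_card (hF : Fintype.card F % 4 = 3) : ringChar F ≠ 2 := by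
  intro h
  have := FiniteField.even_card_of_char_two h
  omega

theorem quadraticChar_neg_one_of_card (hF : Fintype.card F % 4 = 3) :
    quadraticChar F (-1) = -1 := by
  rw [quadraticChar_neg_one_iff_not_isSquare, FiniteField.isSquare_neg_one_iff]
  simpa using hF

/-- The symmetrised Jacobi sum `J(φ, ψ) + J(φ, ψ⁻¹)`, where `φ` is the quadratic character. -/
noncomputable def jacobiPair (ψ : MulChar F R) : R :=
  jacobiSum (quadraticCharIn F R) ψ + jacobiSum (quadraticCharIn F R) ψ⁻¹

theorem jacobiPair_inv (ψ : MulChar F R) : jacobiPair ψ⁻¹ = jacobiPair ψ := by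
  rw [jacobiPair, jacobiPair, inv_inv, add_comm]

theorem jacobiPair_ringHomComp {R' : Type*} [CommRing R'] (f : R →+* R') (ψ : MulChar F R) :
    jacobiPair (ψ.ringHomComp f) = f (jacobiPair ψ) := by
  rw [jacobiPair, jacobiPair, map_add, MulChar.ringHomComp_inv, ← quadraticCharIn_ringHomComp f,
    jacobiSum_ringHomComp, jacobiSum_ringHomComp]

/-- Substitute x ↦ x⁻¹, using 1 - x = -x(1 - x⁻¹): the factor φ(x) this produces cancels the φ in
φψ. -/
theorem jacobiSum_quadraticCharIn_mul (ψ : MulChar F R) :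
    jacobiSum (quadraticCharIn F R) (quadraticCharIn F R * ψ) =
      quadraticCharIn F R (-1) * jacobiSum (quadraticCharIn F R) ψ⁻¹ := by
  set φ := quadraticCharIn F R
  have key : ∀ x : F, φ (1 - x) * (φ * ψ) x = φ (-1) * (φ (1 - x⁻¹) * ψ x) := by
    intro x
    rcases eq_or_ne x 0 with rfl | hx
    · simp [MulChar.map_zero]
    · have h1 : φ (1 - x) = φ (-1) * φ (1 - x⁻¹) * φ x := by
        rw [← map_mul, ← map_mul]
        congr 1
        field_simp
        ring
      have h2 : φ x * φ x = 1 := by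
        have := congrArg (fun χ : MulChar F R ↦ χ x) (quadraticCharIn_mul_self (F := F) (R := R))
        simpa [MulChar.one_apply hx.isUnit] using this
      rw [MulChar.mul_apply, h1]
      linear_combination φ (-1) * φ (1 - x⁻¹) * ψ x * h2
  rw [jacobiSum_comm φ ψ⁻¹, jacobiSum_comm]
  simp only [jacobiSum]
  rw [← Equiv.sum_comp (Equiv.inv F) (fun x ↦ ψ⁻¹ x * φ (1 - x)), Finset.mul_sum]
  refine Finset.sum_congr rfl fun x _ ↦ ?_
  simp only [Equiv.inv_apply, MulChar.inv_apply', inv_inv]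
  rw [mul_comm, key, mul_comm (ψ x)]

/-- Multiplying by φ swaps the two Jacobi sums, each picking up the factor φ(-1) = -1. -/
theorem jacobiPair_quadraticCharIn_mul (hF : Fintype.card F % 4 = 3) (ψ : MulChar F R) :
    jacobiPair (quadraticCharIn F R * ψ) = -jacobiPair ψ := by
  have h : quadraticCharIn F R (-1) = -1 := by
    rw [quadraticCharIn_apply, quadraticChar_neg_one_of_card hF]; simp
  rw [jacobiPair, jacobiPair, mul_inv_rev, quadraticCharIn_inv, mul_comm ψ⁻¹,
    jacobiSum_quadraticCharIn_mul, jacobiSum_quadraticCharIn_mul, h, inv_inv]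
  ring

theorem sum_quadraticCharIn_one_add_mul (ψ : MulChar F R) :
    ∑ x, quadraticCharIn F R (1 + x) * ψ x =
      ψ (-1) * jacobiSum (quadraticCharIn F R) ψ := by
  rw [jacobiSum, Finset.mul_sum, ← Equiv.sum_comp (Equiv.addLeft (1 : F)) fun x ↦ ψ (-1) * _]
  refine Finset.sum_congr rfl fun x _ ↦ ?_
  simp only [Equiv.coe_addLeft]
  rw [show (1 : F) - (1 + x) = -1 * x by ring, map_mul]
  have h : ψ (-1) * ψ (-1) = 1 := by rw [← map_mul]; simp
  linear_combination -(quadraticCharIn F R (1 + x) * ψ x) * h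

theorem jacobiPair_one [IsDomain R] [CharZero R] (hF : Fintype.card F % 4 = 3) :
    jacobiPair (1 : MulChar F R) = -2 := by
  have h : quadraticCharIn F R ≠ 1 := by
    intro h
    refine quadraticChar_ne_one (ringChar_ne_two_of_card hF) ?_
    rw [← MulChar.ringHomComp_eq_one_iff (f := Int.castRingHom R) Int.cast_injective]
    exact h
  rw [jacobiPair, inv_one, jacobiSum_comm, jacobiSum_one_nontrivial h]
  norm_num

/-- Twice a sum over the nonzero squares is a sum over the field weighted by `φ² + φ`. -/
theorem two_mul_sum_nonzeroSquares (h : F → R) :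
    2 * ∑ s : NonzeroSquares F, h s =
      ∑ x, h x * (quadraticCharIn F R x ^ 2 + quadraticCharIn F R x) := by
  rw [← Finset.sum_subtype (Finset.univ.filter fun s : F ↦ s ≠ 0 ∧ IsSquare s) (by simp) h,
    Finset.sum_filter, Finset.mul_sum]
  refine Finset.sum_congr rfl fun x _ ↦ ?_
  rw [quadraticCharIn_apply]
  rcases eq_or_ne x 0 with rfl | hx
  · simp
  · by_cases hs : IsSquare x
    · rw [if_pos ⟨hx, hs⟩, (quadraticChar_one_iff_isSquare hx).2 hs]
      push_cast
      ring
    · rw [if_neg (fun h ↦ hs h.2), quadraticChar_neg_one_iff_not_isSquare.2 hs]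
      simp

/-- The eigenvector relation for 2A. After scaling x by t, the φ² part of the weight gives J(φ, ψ)
and the φ part gives (φψ)(-1) J(φ, φψ) = J(φ, ψ⁻¹). -/
theorem two_mul_sum_nonzeroSquares_mul (hF : Fintype.card F % 4 = 3) {ψ : MulChar F R}
    (hψ : ψ (-1) = 1) (t : NonzeroSquares F) :
    2 * ∑ s : NonzeroSquares F, ψ s * (quadraticChar F ((s : F) + t) : R) =
      jacobiPair ψ * ψ t := by
  set φ := quadraticCharIn F R with hφ
  have h1 : φ (-1) = -1 := by
    rw [hφ, quadraticCharIn_apply, quadraticChar_neg_one_of_card hF]; simp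
  have ht : φ (t : F) = 1 := by
    rw [hφ, quadraticCharIn_apply, (quadraticChar_one_iff_isSquare t.2.1).2 t.2.2]; simp
  have h2 : ∀ x : F, x ≠ 0 → φ x * φ x = 1 := by
    intro x hx
    have := congrArg (fun χ : MulChar F R ↦ χ x) (quadraticCharIn_mul_self (F := F) (R := R))
    simpa [MulChar.one_apply hx.isUnit] using this
  rw [two_mul_sum_nonzeroSquares (fun x ↦ ψ x * (quadraticChar F (x + t) : R)),
    ← Equiv.sum_comp (Equiv.mulLeft₀ (t : F) t.2.1)]
  have key : ∀ x : F, ψ (t * x) * (quadraticChar F (t * x + t) : R) * (φ (t * x) ^ 2 + φ (t * x)) =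
      (φ (1 + x) * ψ x + φ (1 + x) * (φ * ψ) x) * ψ t := by
    intro x
    rcases eq_or_ne x 0 with rfl | hx
    · simp [MulChar.map_zero]
    · rw [← quadraticCharIn_apply, ← hφ, show (t : F) * x + t = t * (1 + x) by ring,
        map_mul, map_mul, map_mul, ht, MulChar.mul_apply]
      linear_combination ψ t * ψ x * φ (1 + x) * h2 x hx
  change ∑ x, ψ (t * x) * (quadraticChar F (t * x + t) : R) * (φ (t * x) ^ 2 + φ (t * x)) = _
  rw [Finset.sum_congr rfl fun x _ ↦ key x, ← Finset.sum_mul, Finset.sum_add_distrib,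
    sum_quadraticCharIn_one_add_mul, sum_quadraticCharIn_one_add_mul,
    jacobiSum_quadraticCharIn_mul, MulChar.mul_apply, ← hφ, h1, hψ, jacobiPair]
  ring

end CharacterSums

/-! ### Diagonalising the matrix by characters -/

section Determinant

variable {F : Type*} [Field F] [Fintype F] [DecidableEq F]

/-- The even powers of a generator of `Fˣ` enumerate the nonzero squares. -/
noncomputable def evenPowersEquiv {n : ℕ} (hn : 0 < n) (hF : Fintype.card F = 2 * n + 1) {g : Fˣ}
    (hg : ∀ x, x ∈ Subgroup.zpowers g) : Fin n ≃ NonzeroSquares F :=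
  Equiv.ofBijective
    (fun j ↦ ⟨(g : F) ^ (2 * (j : ℕ)), pow_ne_zero _ g.ne_zero, ⟨(g : F) ^ (j : ℕ), by ring⟩⟩) <| by
    have hord : orderOf g = 2 * n := by
      rw [orderOf_eq_card_of_forall_mem_zpowers hg, Nat.card_eq_fintype_card, Fintype.card_units, hF]
      rfl
    constructor
    · intro i j hij
      have h : g ^ (2 * (i : ℕ)) = g ^ (2 * (j : ℕ)) := by
        ext
        simpa using congrArg Subtype.val hij
      rw [pow_inj_mod, hord, Nat.mul_mod_mul_left, Nat.mul_mod_mul_left, Nat.mod_eq_of_lt i.2,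
        Nat.mod_eq_of_lt j.2] at h
      ext
      omega
    · rintro ⟨x, hx, y, rfl⟩
      have hy : y ≠ 0 := left_ne_zero_of_mul hx
      obtain ⟨i, hi⟩ := (Submonoid.mem_powers_iff _ _).1
        (mem_powers_iff_mem_zpowers.2 (hg (Units.mk0 y hy)))
      refine ⟨⟨i % n, Nat.mod_lt _ hn⟩, Subtype.ext ?_⟩
      have h : g ^ (2 * (i % n)) = Units.mk0 y hy * Units.mk0 y hy := by
        rw [← hi, ← pow_add, ← two_mul, pow_inj_mod, hord, Nat.mul_mod_mul_left,
          Nat.mul_mod_mul_left, Nat.mod_mod]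
      simpa using congrArg Units.val h

theorem evenPowersEquiv_apply {n : ℕ} (hn : 0 < n) (hF : Fintype.card F = 2 * n + 1) {g : Fˣ}
    (hg : ∀ x, x ∈ Subgroup.zpowers g) (j : Fin n) :
    (evenPowersEquiv hn hF hg j : F) = (g : F) ^ (2 * (j : ℕ)) := rfl

variable {R : Type*} [CommRing R] [IsDomain R]

omit [Fintype F] [DecidableEq F] [IsDomain R] in
theorem apply_neg_one_eq_one_of_pow_eq_one {n : ℕ} (hn : Odd n) {ψ : MulChar F R}
    (hψ : ψ ^ n = 1) : ψ (-1) = 1 := by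
  have h : (ψ ^ n) (-1) = 1 := by rw [hψ, MulChar.one_apply isUnit_one.neg]
  rwa [MulChar.pow_apply' _ hn.pos.ne', ← map_pow, hn.neg_one_pow] at h

omit [Fintype F] [DecidableEq F] [IsDomain R] in
theorem pow_eq_one_of_apply_generator {n : ℕ} {g : Fˣ} (hg : ∀ x, x ∈ Subgroup.zpowers g)
    {ψ : MulChar F R} (hψ : ψ g ^ n = 1) : ψ ^ n = 1 := by
  rw [MulChar.eq_iff hg, MulChar.pow_apply_coe, MulChar.one_apply_coe, hψ]

theorem two_pow_mul_det_squareSumMatrix {n : ℕ} (hn : Odd n) (hF : Fintype.card F = 2 * n + 1)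
    {g : Fˣ} (hg : ∀ x, x ∈ Subgroup.zpowers g) {η : MulChar F R}
    (hη : IsPrimitiveRoot (η g) n) :
    2 ^ n * ((squareSumMatrix F).det : R) = ∏ k ∈ Finset.range n, jacobiPair (η ^ k) := by
  have hF4 : Fintype.card F % 4 = 3 := by obtain ⟨m, rfl⟩ := hn; omega
  have hηn : η ^ n = 1 := pow_eq_one_of_apply_generator hg hη.pow_eq_one
  set e := evenPowersEquiv hn.pos hF hg with he
  let M : Matrix (NonzeroSquares F) (NonzeroSquares F) R :=
    (2 : R) • (Int.castRingHom R).mapMatrix (squareSumMatrix F)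
  let P : Matrix (Fin n) (NonzeroSquares F) R := Matrix.of fun k s ↦ (η ^ (k : ℕ)) (s : F)
  let D : Matrix (Fin n) (Fin n) R := Matrix.diagonal fun k ↦ jacobiPair (η ^ (k : ℕ))
  have hPM : P * M = D * P := by
    ext k t
    have h1 : (η ^ (k : ℕ)) (-1) = 1 :=
      apply_neg_one_eq_one_of_pow_eq_one hn (by rw [← pow_mul, mul_comm, pow_mul, hηn, one_pow])
    rw [Matrix.diagonal_mul, Matrix.mul_apply]
    refine Eq.trans ?_ (two_mul_sum_nonzeroSquares_mul hF4 h1 t)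
    rw [Finset.mul_sum]
    refine Finset.sum_congr rfl fun s _ ↦ ?_
    simp only [P, M, squareSumMatrix, Matrix.of_apply, Matrix.smul_apply, RingHom.mapMatrix_apply,
      Matrix.map_apply, smul_eq_mul, eq_intCast]
    ring
  -- In the enumeration by even powers of g, the character table is Vandermonde with nodes the
  -- powers of η(g)². As n is odd, η(g)² is still a primitive n-th root of unity, so the nodes are
  -- distinct.
  have hdet : (P.submatrix id e).det ≠ 0 := by
    have hV : P.submatrix id e = Matrix.vandermonde fun k : Fin n ↦ (η g ^ 2) ^ (k : ℕ) := by
      ext k j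
      simp only [P, Matrix.submatrix_apply, Matrix.of_apply, id, Matrix.vandermonde_apply, he,
        evenPowersEquiv_apply]
      rw [map_pow, MulChar.pow_apply_coe]
      ring
    rw [hV, Matrix.det_vandermonde_ne_zero_iff]
    intro i j hij
    exact Fin.ext ((hη.pow_of_coprime 2 (Nat.coprime_two_left.2 hn)).pow_inj i.2 j.2 hij)
  have h := congrArg (fun N ↦ (N.submatrix id e).det) hPM
  rw [← Matrix.submatrix_mul_equiv P M id e e, ← Matrix.submatrix_mul_equiv D P id (Equiv.refl _) e,
    Matrix.det_mul, Matrix.det_mul, Matrix.det_submatrix_equiv_self] at h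
  have h2 : M.det = (D.submatrix id (Equiv.refl _)).det := by
    apply mul_left_cancel₀ hdet
    rw [h, mul_comm]
    rfl
  have h3 : M.det = 2 ^ n * ((squareSumMatrix F).det : R) := by
    rw [Matrix.det_smul, ← RingHom.map_det, ← Fintype.card_congr e, Fintype.card_fin, eq_intCast]
  rw [← h3, h2]
  simp only [D, Equiv.coe_refl, Matrix.submatrix_id_id, Matrix.det_diagonal]
  exact Fin.prod_univ_eq_prod_range (fun k ↦ jacobiPair (η ^ k)) n

/-- The factor k = 0 is -2, and k pairs with 2m + 1 - k because η^(2m+1-k) = (η^k)⁻¹. -/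
theorem prod_jacobiPair_range {m : ℕ} [CharZero R] (hF : Fintype.card F % 4 = 3) {η : MulChar F R}
    (hη : η ^ (2 * m + 1) = 1) :
    ∏ k ∈ Finset.range (2 * m + 1), jacobiPair (η ^ k) =
      -(2 * (∏ k ∈ Finset.Icc 1 m, jacobiPair (η ^ k)) ^ 2) := by
  have h1 : ∏ k ∈ Finset.Icc 1 m, jacobiPair (η ^ k) =
      ∏ k ∈ Finset.range m, jacobiPair (η ^ (k + 1)) := by
    rw [Finset.range_eq_Ico, Finset.prod_Ico_add' (fun k ↦ jacobiPair (η ^ k)) 0 m 1]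
    rfl
  rw [Finset.prod_range_succ', pow_zero, jacobiPair_one hF, two_mul, Finset.prod_range_add,
    ← Finset.prod_range_reflect (fun x ↦ jacobiPair (η ^ (m + x + 1))), h1]
  have h2 : ∀ k ∈ Finset.range m, jacobiPair (η ^ (m + (m - 1 - k) + 1)) =
      jacobiPair (η ^ (k + 1)) := by
    intro k hk
    rw [Finset.mem_range] at hk
    rw [← jacobiPair_inv]
    congr 1
    rw [inv_eq_iff_mul_eq_one, ← pow_add, ← hη]
    congr 1
    omega
  rw [Finset.prod_congr rfl h2]
  ring

theorem neg_two_pow_mul_det_squareSumMatrix {m : ℕ} [CharZero R]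
    (hF : Fintype.card F = 2 * (2 * m + 1) + 1)
    {g : Fˣ} (hg : ∀ x, x ∈ Subgroup.zpowers g) {η : MulChar F R}
    (hη : IsPrimitiveRoot (η g) (2 * m + 1)) :
    (∏ k ∈ Finset.Icc 1 m, jacobiPair (η ^ k)) ^ 2 =
      -(2 ^ (2 * m) * ((squareSumMatrix F).det : R)) := by
  have h := two_pow_mul_det_squareSumMatrix (odd_two_mul_add_one m) hF hg hη
  rw [prod_jacobiPair_range (by omega) (pow_eq_one_of_apply_generator hg hη.pow_eq_one)] at h
  apply mul_left_cancel₀ (two_ne_zero : (2 : R) ≠ 0)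
  linear_combination h

/-- The product of symmetrised Jacobi sums depends only on the group generated by `η`. -/
theorem prod_jacobiPair_congr {m : ℕ} {g : Fˣ} (hg : ∀ x, x ∈ Subgroup.zpowers g)
    {η η' : MulChar F R} (hη : IsPrimitiveRoot (η g) (2 * m + 1))
    (hη' : IsPrimitiveRoot (η' g) (2 * m + 1)) :
    ∏ k ∈ Finset.Icc 1 m, jacobiPair (η ^ k) = ∏ k ∈ Finset.Icc 1 m, jacobiPair (η' ^ k) := by
  classical
  -- Each factor depends only on the unordered pair {ψ, ψ⁻¹}. Either η or η' lists every such pair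
  -- with ψ nontrivial and ψ^(2m+1) = 1 exactly once.
  let J : Sym2 (MulChar F R) → R := Sym2.lift
    ⟨fun ψ ψ' ↦ jacobiSum (quadraticCharIn F R) ψ + jacobiSum (quadraticCharIn F R) ψ',
      fun _ _ ↦ add_comm _ _⟩
  have hJ : ∀ θ : MulChar F R, ∀ k, jacobiPair (θ ^ k) = J s(θ ^ k, (θ ^ k)⁻¹) := fun _ _ ↦ rfl
  have hinj : ∀ θ : MulChar F R, IsPrimitiveRoot (θ g) (2 * m + 1) →
      Set.InjOn (fun k ↦ s(θ ^ k, (θ ^ k)⁻¹)) (Finset.Icc 1 m : Finset ℕ) := by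
    intro θ hθ i hi j hj hij
    rw [Finset.mem_coe, Finset.mem_Icc] at hi hj
    have heval : ∀ k, (θ ^ k) g = θ g ^ k := fun k ↦ MulChar.pow_apply_coe θ k g
    rcases Sym2.eq_iff.1 hij with ⟨h, -⟩ | ⟨h, -⟩
    · refine hθ.pow_inj (by omega) (by omega) ?_
      rw [← heval, ← heval, h]
    · exfalso
      have h2 : θ ^ (i + j) = 1 := by rw [pow_add, h, inv_mul_cancel]
      have h3 : θ g ^ (i + j) = 1 := by rw [← heval, h2, MulChar.one_apply_coe]
      have := Nat.le_of_dvd (by omega) (hθ.dvd_of_pow_eq_one _ h3)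
      omega
  have himage : ∀ θ : MulChar F R, IsPrimitiveRoot (θ g) (2 * m + 1) → ∀ z,
      z ∈ (Finset.Icc 1 m).image (fun k ↦ s(θ ^ k, (θ ^ k)⁻¹)) ↔
        ∃ ψ : MulChar F R, ψ ^ (2 * m + 1) = 1 ∧ ψ ≠ 1 ∧ z = s(ψ, ψ⁻¹) := by
    intro θ hθ z
    have hθ1 : θ ^ (2 * m + 1) = 1 := pow_eq_one_of_apply_generator hg hθ.pow_eq_one
    have heval : ∀ k, (θ ^ k) g = θ g ^ k := fun k ↦ MulChar.pow_apply_coe θ k g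
    rw [Finset.mem_image]
    constructor
    · rintro ⟨k, hk, rfl⟩
      rw [Finset.mem_Icc] at hk
      refine ⟨θ ^ k, by rw [← pow_mul, mul_comm, pow_mul, hθ1, one_pow], fun h ↦ ?_, rfl⟩
      have h3 : θ g ^ k = 1 := by rw [← heval, h, MulChar.one_apply_coe]
      have := Nat.le_of_dvd (by omega) (hθ.dvd_of_pow_eq_one _ h3)
      omega
    · rintro ⟨ψ, hψ, hψ1, rfl⟩
      have h4 : ψ g ^ (2 * m + 1) = 1 := by
        rw [← MulChar.pow_apply_coe, hψ, MulChar.one_apply_coe]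
      obtain ⟨i, hi, hi'⟩ := hθ.eq_pow_of_pow_eq_one h4
      obtain rfl : θ ^ i = ψ := by rw [MulChar.eq_iff hg, heval, hi']
      have hi0 : i ≠ 0 := by rintro rfl; exact hψ1 (pow_zero θ)
      rcases le_or_gt i m with him | him
      · exact ⟨i, Finset.mem_Icc.2 ⟨by omega, him⟩, rfl⟩
      -- An exponent in the upper half gives the same unordered pair as its inverse in the lower
      -- half.
      · refine ⟨2 * m + 1 - i, Finset.mem_Icc.2 ⟨by omega, by omega⟩, ?_⟩
        have h5 : θ ^ (2 * m + 1 - i) = (θ ^ i)⁻¹ := by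
          rw [eq_inv_iff_mul_eq_one, ← pow_add, Nat.sub_add_cancel hi.le, hθ1]
        rw [h5, inv_inv, Sym2.eq_swap]
  simp only [hJ]
  rw [← Finset.prod_image (f := J) (hinj η hη), ← Finset.prod_image (f := J) (hinj η' hη')]
  congr 1
  ext z
  rw [himage η hη, himage η' hη']

theorem IsPrimitiveRoot.neg_of_two_mul {n : ℕ} (hn : Odd n) {ζ : R}
    (hζ : IsPrimitiveRoot ζ (2 * n)) : IsPrimitiveRoot (-ζ) n := by
  have h1 : ζ ^ n = -1 := by
    have h : (ζ ^ n) ^ 2 = 1 := by rw [← pow_mul, mul_comm, hζ.pow_eq_one]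
    exact (mul_self_eq_one_iff.1 ((sq _).symm.trans h)).resolve_left
      (hζ.pow_ne_one_of_pos_of_lt hn.pos.ne' (by have := hn.pos; omega))
  refine ⟨by rw [hn.neg_pow, h1, neg_neg], fun l hl ↦ ?_⟩
  have h2 : ζ ^ (2 * l) = 1 := by rw [pow_mul, ← neg_sq, ← pow_mul, mul_comm, pow_mul, hl, one_pow]
  exact Nat.dvd_of_mul_dvd_mul_left two_pos (hζ.dvd_of_pow_eq_one _ h2)

omit [IsDomain R] in
theorem quadraticCharIn_generator (hF : ringChar F ≠ 2) {g : Fˣ}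
    (hg : ∀ x, x ∈ Subgroup.zpowers g) : quadraticCharIn F R g = -1 := by
  have h : quadraticChar F g ≠ 1 := by
    intro h
    refine quadraticChar_ne_one hF ((MulChar.eq_iff hg _ _).2 ?_)
    rw [h, MulChar.one_apply_coe]
  rw [quadraticCharIn_apply, (quadraticChar_dichotomy g.ne_zero).resolve_left h]
  simp

theorem isPrimitiveRoot_mul_quadraticCharIn {m : ℕ} (hF : Fintype.card F = 2 * (2 * m + 1) + 1)
    {g : Fˣ} (hg : ∀ x, x ∈ Subgroup.zpowers g) {χ : MulChar F R}
    (hχ : IsPrimitiveRoot (χ g) (2 * (2 * m + 1))) :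
    IsPrimitiveRoot ((χ * quadraticCharIn F R) g) (2 * m + 1) := by
  rw [MulChar.mul_apply, quadraticCharIn_generator (ringChar_ne_two_of_card (by omega)) hg,
    mul_neg_one]
  exact IsPrimitiveRoot.neg_of_two_mul (odd_two_mul_add_one m) hχ

omit [IsDomain R] in
theorem jacobiPair_pow_mul_quadraticCharIn (hF : Fintype.card F % 4 = 3) (χ : MulChar F R) (k : ℕ) :
    jacobiPair ((χ * quadraticCharIn F R) ^ k) = (-1) ^ k * jacobiPair (χ ^ k) := by
  have h : (quadraticCharIn F R) ^ 2 = 1 := by rw [sq, quadraticCharIn_mul_self]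
  rw [mul_pow, mul_comm]
  rcases Nat.even_or_odd' k with ⟨i, rfl | rfl⟩
  · rw [pow_mul _ 2 i, h, one_pow, one_mul, pow_mul (-1 : R), neg_one_sq, one_pow, one_mul]
  · rw [pow_succ _ (2 * i), pow_mul _ 2 i, h, one_pow, one_mul,
      jacobiPair_quadraticCharIn_mul hF, pow_succ (-1 : R), pow_mul (-1 : R), neg_one_sq, one_pow]
    ring

omit [IsDomain R] in
theorem prod_jacobiPair_pow (hF : Fintype.card F % 4 = 3) (χ : MulChar F R) (m : ℕ) :
    ∏ k ∈ Finset.Icc 1 m, jacobiPair (χ ^ k) = (∏ k ∈ Finset.Icc 1 m, (-1) ^ k) *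
      ∏ k ∈ Finset.Icc 1 m, jacobiPair ((χ * quadraticCharIn F R) ^ k) := by
  rw [← Finset.prod_mul_distrib]
  refine Finset.prod_congr rfl fun k _ ↦ ?_
  rw [jacobiPair_pow_mul_quadraticCharIn hF, ← mul_assoc, ← pow_add, ← two_mul, pow_mul,
    neg_one_sq, one_pow, one_mul]

theorem sq_prod_jacobiPair_generator {m : ℕ} [CharZero R]
    (hF : Fintype.card F = 2 * (2 * m + 1) + 1) {g : Fˣ} (hg : ∀ x, x ∈ Subgroup.zpowers g)
    {χ : MulChar F R} (hχ : IsPrimitiveRoot (χ g) (2 * (2 * m + 1))) :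
    (∏ k ∈ Finset.Icc 1 m, jacobiPair (χ ^ k)) ^ 2 =
      -(2 ^ (2 * m) * ((squareSumMatrix F).det : R)) := by
  rw [prod_jacobiPair_pow (by omega), mul_pow, neg_two_pow_mul_det_squareSumMatrix hF hg
    (isPrimitiveRoot_mul_quadraticCharIn hF hg hχ), ← Finset.prod_pow,
    Finset.prod_eq_one, one_mul]
  intro k _
  rw [← pow_mul, mul_comm, pow_mul, neg_one_sq, one_pow]

/-- The sign relating the products for χ and χφ depends on m alone, so independence for χφ of order
n carries over to χ. This is what makes the product Galois-invariant. -/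
theorem prod_jacobiPair_generator_congr {m : ℕ}
    (hF : Fintype.card F = 2 * (2 * m + 1) + 1) {g : Fˣ} (hg : ∀ x, x ∈ Subgroup.zpowers g)
    {χ χ' : MulChar F R} (hχ : IsPrimitiveRoot (χ g) (2 * (2 * m + 1)))
    (hχ' : IsPrimitiveRoot (χ' g) (2 * (2 * m + 1))) :
    ∏ k ∈ Finset.Icc 1 m, jacobiPair (χ ^ k) = ∏ k ∈ Finset.Icc 1 m, jacobiPair (χ' ^ k) := by
  rw [prod_jacobiPair_pow (by omega), prod_jacobiPair_pow (by omega) χ',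
    prod_jacobiPair_congr hg (isPrimitiveRoot_mul_quadraticCharIn hF hg hχ)
      (isPrimitiveRoot_mul_quadraticCharIn hF hg hχ')]

end Determinant

/-! ### Integrality, and specialisation from ℤ[X]/Φ_N -/

section Integrality

open Polynomial

variable {F : Type*} [Field F] [Fintype F] [DecidableEq F]

omit [DecidableEq F] in
theorem isPrimitiveRoot_of_generator {N : ℕ} (hF : Fintype.card F = N + 1) {g : Fˣ}
    (hg : ∀ x, x ∈ Subgroup.zpowers g) : IsPrimitiveRoot (g : F) N := by
  classical
  have hord : orderOf g = N := by
    rw [orderOf_eq_card_of_forall_mem_zpowers hg, Nat.card_eq_fintype_card, Fintype.card_units, hF]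
    rfl
  rw [IsPrimitiveRoot.coe_units_iff, ← hord]
  exact IsPrimitiveRoot.orderOf g

omit [DecidableEq F] in
theorem exists_mulChar_apply_generator {N : ℕ} (hN : 0 < N) (hF : Fintype.card F = N + 1) {g : Fˣ}
    (hg : ∀ x, x ∈ Subgroup.zpowers g) {R : Type*} [CommRing R] {z : R} (hz : z ^ N = 1) :
    ∃ χ : MulChar F R, χ g = z := by
  classical
  let u : Rˣ := Units.ofPowEqOne z N hz hN.ne'
  have hu : u ∈ rootsOfUnity (Fintype.card Fˣ) R := by
    rw [mem_rootsOfUnity, Fintype.card_units, hF]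
    exact Units.pow_ofPowEqOne hz hN.ne'
  exact ⟨MulChar.ofRootOfUnity hu hg, MulChar.ofRootOfUnity_spec hu hg⟩

/-- The ring homomorphism `ℤ[X] / Φ_N → R` sending the class of `X` to a primitive `N`-th root of
unity. -/
noncomputable def cyclotomicLift {N : ℕ} (hN : 0 < N) {R : Type*} [CommRing R] [IsDomain R] {z : R}
    (hz : IsPrimitiveRoot z N) : AdjoinRoot (cyclotomic N ℤ) →+* R :=
  AdjoinRoot.lift (Int.castRingHom R) z <| by
    rw [← eval_map, map_cyclotomic]
    exact hz.isRoot_cyclotomic hN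

theorem cyclotomicLift_root {N : ℕ} (hN : 0 < N) {R : Type*} [CommRing R] [IsDomain R] {z : R}
    (hz : IsPrimitiveRoot z N) :
    cyclotomicLift hN hz (AdjoinRoot.root (cyclotomic N ℤ)) = z :=
  AdjoinRoot.lift_root _

theorem cyclotomicLift_injective {N : ℕ} (hN : 0 < N) {L : Type*} [Field L] [CharZero L] {z : L}
    (hz : IsPrimitiveRoot z N) : Function.Injective (cyclotomicLift hN hz) := by
  rw [injective_iff_map_eq_zero]
  intro a
  induction a using AdjoinRoot.induction_on with
  | ih f =>
    intro h
    rw [cyclotomicLift, AdjoinRoot.lift_mk] at h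
    rw [AdjoinRoot.mk_eq_zero, cyclotomic_eq_minpoly hz hN]
    exact minpoly.isIntegrallyClosed_dvd (hz.isIntegral hN) h

theorem root_cyclotomic_pow_eq_one (N : ℕ) :
    AdjoinRoot.root (cyclotomic N ℤ) ^ N = 1 := by
  have h : AdjoinRoot.mk (cyclotomic N ℤ) (X ^ N - 1) = 0 :=
    AdjoinRoot.mk_eq_zero.2 (cyclotomic.dvd_X_pow_sub_one N ℤ)
  rwa [map_sub, map_pow, map_one, AdjoinRoot.mk_X, sub_eq_zero] at h

theorem prod_jacobiPair_ringHomComp {R R' : Type*} [CommRing R] [CommRing R'] (f : R →+* R')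
    (χ : MulChar F R) (s : Finset ℕ) :
    ∏ k ∈ s, jacobiPair ((χ.ringHomComp f) ^ k) = f (∏ k ∈ s, jacobiPair (χ ^ k)) := by
  rw [map_prod]
  refine Finset.prod_congr rfl fun k _ ↦ ?_
  rw [MulChar.ringHomComp_pow, jacobiPair_ringHomComp]

/-- Every such ψ is a base change of one universal character. The target may have characteristic 0
or be F itself, so reduction modulo p needs no choice of a prime ideal. -/
theorem prod_jacobiPair_eq_cyclotomicLift {N : ℕ} (hN : 0 < N) {g : Fˣ}
    (hg : ∀ x, x ∈ Subgroup.zpowers g) {χ : MulChar F (AdjoinRoot (cyclotomic N ℤ))}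
    (hχ : χ g = AdjoinRoot.root _) {R : Type*} [CommRing R] [IsDomain R] {ψ : MulChar F R}
    (hψ : IsPrimitiveRoot (ψ g) N) (s : Finset ℕ) :
    ∏ k ∈ s, jacobiPair (ψ ^ k) = cyclotomicLift hN hψ (∏ k ∈ s, jacobiPair (χ ^ k)) := by
  have h : ψ = χ.ringHomComp (cyclotomicLift hN hψ) := by
    rw [MulChar.eq_iff hg, MulChar.ringHomComp_apply, hχ, cyclotomicLift_root]
  rw [← prod_jacobiPair_ringHomComp, ← h]

theorem exists_int_prod_jacobiPair_adjoinRoot {m N : ℕ} (hN : N = 2 * (2 * m + 1))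
    (hF : Fintype.card F = N + 1) {g : Fˣ} (hg : ∀ x, x ∈ Subgroup.zpowers g)
    {χ : MulChar F (AdjoinRoot (cyclotomic N ℤ))} (hχ : χ g = AdjoinRoot.root _) :
    ∃ r : ℤ, ∏ k ∈ Finset.Icc 1 m, jacobiPair (χ ^ k) = r := by
  have hN0 : 0 < N := by omega
  have : NeZero N := ⟨hN0.ne'⟩
  have : NeZero (N : ℚ) := ⟨by exact_mod_cast hN0.ne'⟩
  let L := CyclotomicField N ℚ
  have : IsCyclotomicExtension {N} ℚ L := CyclotomicField.isCyclotomicExtension N ℚ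
  have hζ : IsPrimitiveRoot (IsCyclotomicExtension.zeta N ℚ L) N :=
    IsCyclotomicExtension.zeta_spec N ℚ L
  have : IsGalois ℚ L := IsCyclotomicExtension.isGalois {N} ℚ L
  have : FiniteDimensional ℚ L := IsCyclotomicExtension.finiteDimensional {N} ℚ L
  set f := cyclotomicLift hN0 hζ
  set E := ∏ k ∈ Finset.Icc 1 m, jacobiPair (χ ^ k)
  have hχL : IsPrimitiveRoot ((χ.ringHomComp f) g) N := by
    rw [MulChar.ringHomComp_apply, hχ, cyclotomicLift_root]
    exact hζ
  -- An automorphism σ turns the character into another one whose value at g is a primitive N-th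
  -- root of unity, and the product is the same for all of these.
  have hbot : f E ∈ (⊥ : IntermediateField ℚ L) := by
    rw [IsGalois.mem_bot_iff_fixed]
    intro σ
    rw [← prod_jacobiPair_ringHomComp]
    have h := prod_jacobiPair_ringHomComp (σ : L →+* L) (χ.ringHomComp f) (Finset.Icc 1 m)
    refine Eq.trans h.symm (prod_jacobiPair_generator_congr (hN ▸ hF) hg ?_ (hN ▸ hχL))
    exact hN ▸ hχL.map_of_injective (f := (σ : L →+* L)) σ.injective
  obtain ⟨q, hq⟩ := IntermediateField.mem_bot.1 hbot
  have : Module.Finite ℤ (AdjoinRoot (cyclotomic N ℤ)) := (cyclotomic.monic N ℤ).finite_adjoinRoot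
  have hint : IsIntegral ℤ (f E) :=
    (Algebra.IsIntegral.isIntegral (R := ℤ) E).map f.toIntAlgHom
  rw [← hq, isIntegral_algebraMap_iff (algebraMap ℚ L).injective,
    IsIntegrallyClosed.isIntegral_iff] at hint
  obtain ⟨r, rfl⟩ := hint
  refine ⟨r, cyclotomicLift_injective hN0 hζ ?_⟩
  rw [map_intCast]
  refine hq.symm.trans ?_
  simp

/-- The product of symmetrised Jacobi sums is an integer, the same for all generating characters,
and its residue is the analogous product for the tautological character of `F`. -/
theorem exists_int_prod_jacobiPair {m N : ℕ} (hN : N = 2 * (2 * m + 1))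
    (hF : Fintype.card F = N + 1) {g : Fˣ} (hg : ∀ x, x ∈ Subgroup.zpowers g)
    (K : Type*) [Field K] [CharZero K] {ι : MulChar F F} (hι : ι g = g) :
    ∃ r : ℤ, (∀ χ : MulChar F K, IsPrimitiveRoot (χ g) N →
      ∏ k ∈ Finset.Icc 1 m, jacobiPair (χ ^ k) = r) ∧
      (r : F) = ∏ k ∈ Finset.Icc 1 m, jacobiPair (ι ^ k) := by
  have hN0 : 0 < N := by omega
  obtain ⟨χ, hχ⟩ := exists_mulChar_apply_generator hN0 hF hg (root_cyclotomic_pow_eq_one N)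
  obtain ⟨r, hr⟩ := exists_int_prod_jacobiPair_adjoinRoot hN hF hg hχ
  refine ⟨r, fun ψ hψ ↦ ?_, ?_⟩
  · rw [prod_jacobiPair_eq_cyclotomicLift hN0 hg hχ hψ, hr, map_intCast]
  · rw [prod_jacobiPair_eq_cyclotomicLift hN0 hg hχ
      (hι.symm ▸ isPrimitiveRoot_of_generator hF hg), hr, map_intCast]

end Integrality

/-! ### Jacobi sums with values in F as binomial coefficients -/

section Reduction

variable {F : Type*} [Field F] [Fintype F]

theorem sum_pow_eq_ite {N i : ℕ} (hN : 0 < N) (hF : Fintype.card F = N + 1) (hi : i < 2 * N) :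
    ∑ x : F, x ^ i = if i = N then -1 else 0 := by
  classical
  have hlt : ∀ j < N, ∑ x : F, x ^ j = 0 := fun j hj ↦
    FiniteField.sum_pow_lt_card_sub_one F j (by omega)
  rcases lt_trichotomy i N with h | rfl | h
  · rw [hlt i h, if_neg h.ne]
  · have h1 : ∀ x : F, x ^ i = 1 - if x = 0 then 1 else 0 := by
      intro x
      split_ifs with hx
      · simp [hx, hN.ne']
      · have := FiniteField.pow_card_sub_one_eq_one x hx
        rw [hF, Nat.add_sub_cancel] at this
        rw [this, sub_zero]
    have h2 : ((i + 1 : ℕ) : F) = 0 := by rw [← hF, FiniteField.cast_card_eq_zero]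
    simp only [h1, Finset.sum_sub_distrib, Finset.sum_ite_eq', Finset.mem_univ, if_true,
      Finset.sum_const, Finset.card_univ, hF, nsmul_eq_mul, mul_one, h2, zero_sub]
  · rw [if_neg h.ne', ← hlt (i - N) (by omega)]
    refine Finset.sum_congr rfl fun x _ ↦ ?_
    have h3 : x ^ (N + 1) = x := by rw [← hF, FiniteField.pow_card]
    rw [show i = N + 1 + (i - N - 1) by omega, pow_add, h3, ← pow_succ']
    congr 1
    omega

/-- Expand (1 - x)^l: only the exponent n + j = 2n has a nonzero power sum, namely -1. -/
theorem sum_pow_mul_one_sub_pow {n l : ℕ} (hn : 0 < n) (hF : Fintype.card F = 2 * n + 1)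
    (hl : l < 2 * n) :
    ∑ x : F, x ^ n * (1 - x) ^ l = -((-1) ^ n * (l.choose n : F)) := by
  have h1 : ∀ x : F, x ^ n * (1 - x) ^ l =
      ∑ j ∈ Finset.range (l + 1), (-1) ^ j * (l.choose j : F) * x ^ (n + j) := by
    intro x
    rw [sub_eq_add_neg, add_comm, add_pow, Finset.mul_sum]
    refine Finset.sum_congr rfl fun j _ ↦ ?_
    rw [one_pow, mul_one, neg_pow, pow_add]
    ring
  simp only [h1]
  rw [Finset.sum_comm]
  simp only [← Finset.mul_sum]
  have h2 : ∀ j ∈ Finset.range (l + 1), (-1) ^ j * (l.choose j : F) * ∑ x : F, x ^ (n + j) =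
      if j = n then -((-1) ^ n * (l.choose n : F)) else 0 := by
    intro j hj
    rw [Finset.mem_range] at hj
    rcases eq_or_ne j n with rfl | hjn
    · rw [sum_pow_eq_ite (N := 2 * j) (by omega) hF (by omega), if_pos (by omega), if_pos rfl]
      ring
    · by_cases h : n + j < 2 * (2 * n)
      · rw [sum_pow_eq_ite (N := 2 * n) (by omega) hF h, if_neg (by omega), if_neg hjn, mul_zero]
      · omega
  rw [Finset.sum_congr rfl h2, Finset.sum_ite_eq']
  split_ifs with h
  · rfl
  · rw [Nat.choose_eq_zero_of_lt (by simpa using h)]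
    simp

variable [DecidableEq F]

/-- In F, φ(x) = x^n, so J(φ, ι^l) = C(l, n) for 0 < l < 2n. This vanishes at l = k < n, and (ι^k)⁻¹
= ι^(2n-k) supplies the other term. -/
theorem jacobiPair_pow_tautological {n k : ℕ} (hn : Odd n) (hF : Fintype.card F = 2 * n + 1)
    {ι : MulChar F F} (hι : ∀ x, ι x = x) (hk : 0 < k) (hkn : k < n) :
    jacobiPair (ι ^ k) = ((2 * n - k).choose n : F) := by
  have hφ : ∀ x : F, quadraticCharIn F F x = x ^ n := by
    intro x
    rw [quadraticCharIn_apply, quadraticChar_eq_pow_of_char_ne_two'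
      (ringChar_ne_two_of_card (by obtain ⟨m, rfl⟩ := hn; omega)), hF]
    congr 1
    omega
  have hinv : (ι ^ k)⁻¹ = ι ^ (2 * n - k) := by
    rw [inv_eq_iff_mul_eq_one, ← pow_add, show k + (2 * n - k) = 2 * n by omega]
    ext x
    rw [MulChar.pow_apply_coe, hι, MulChar.one_apply_coe, ← Units.val_pow_eq_pow_val]
    have := FiniteField.pow_card_sub_one_eq_one (x : F) x.ne_zero
    rw [hF, Nat.add_sub_cancel] at this
    simpa using this
  have hJ : ∀ l, 0 < l → l < 2 * n →
      jacobiSum (quadraticCharIn F F) (ι ^ l) = (l.choose n : F) := by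
    intro l hl hl'
    have h : ∀ x : F, quadraticCharIn F F x * (ι ^ l) (1 - x) = x ^ n * (1 - x) ^ l := by
      intro x
      rw [hφ, MulChar.pow_apply' _ hl.ne', hι]
    rw [jacobiSum, Finset.sum_congr rfl fun x _ ↦ h x, sum_pow_mul_one_sub_pow hn.pos hF hl',
      hn.neg_one_pow]
    ring
  rw [jacobiPair, hinv, hJ k hk (by omega), hJ _ (by omega) (by omega),
    Nat.choose_eq_zero_of_lt hkn, Nat.cast_zero, zero_add]

end Reduction

/-! ### The Legendre symbol of the product of binomial coefficients -/

section Legendre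

open Nat

theorem exists_sum_eq_prod_eq_of_sign {α : Type*} (s : Finset α) (f : α → ℤ)
    (hf : ∀ x ∈ s, f x = 1 ∨ f x = -1) :
    ∃ c : ℕ, ∑ x ∈ s, f x = s.card - 2 * c ∧ ∏ x ∈ s, f x = (-1) ^ c := by
  classical
  induction s using Finset.induction_on with
  | empty => exact ⟨0, by simp⟩
  | insert a s ha ih =>
    obtain ⟨c, h1, h2⟩ := ih fun x hx ↦ hf x (Finset.mem_insert_of_mem hx)
    rw [Finset.sum_insert ha, Finset.prod_insert ha, Finset.card_insert_of_notMem ha, h1, h2]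
    rcases hf a (Finset.mem_insert_self _ _) with h | h
    · exact ⟨c, by rw [h]; push_cast; ring, by rw [h, one_mul]⟩
    · exact ⟨c + 1, by rw [h]; push_cast; ring, by rw [h, pow_succ]; ring⟩

theorem prod_sign_eq_of_sum_eq_zero {α : Type*} (s : Finset α) (f : α → ℤ)
    (hf : ∀ x ∈ s, f x = 1 ∨ f x = -1) (h : ∑ x ∈ s, f x = 0) {t : ℕ} (hs : s.card = 2 * t) :
    ∏ x ∈ s, f x = (-1) ^ t := by
  obtain ⟨c, h1, h2⟩ := exists_sum_eq_prod_eq_of_sign s f hf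
  rw [h, hs] at h1
  rw [h2, show c = t by omega]

theorem prod_neg_one_pow_range_two_mul (t : ℕ) :
    ∏ i ∈ Finset.range (2 * t), (-1 : ℤ) ^ i = (-1) ^ t := by
  induction t with
  | zero => simp
  | succ t ih =>
    rw [mul_add, Finset.prod_range_succ, Finset.prod_range_succ, ih, pow_succ _ (2 * t),
      pow_mul _ 2 t, neg_one_sq, one_pow, pow_succ]
    ring

theorem sum_range_two_mul_eq (f : ℕ → ℤ) (M : ℕ) :
    ∑ j ∈ Finset.range (2 * M), f j = ∑ i ∈ Finset.range M, (f (2 * i) + f (2 * i + 1)) := by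
  induction M with
  | zero => simp
  | succ M ih =>
    rw [mul_add, Finset.sum_range_succ, Finset.sum_range_succ, ih, Finset.sum_range_succ]
    ring

variable {p : ℕ} [Fact p.Prime]

/-- Wilson's theorem is k = 0; moving a factor between the factorials uses l + 1 ≡ -(k + 1) mod p.
-/
theorem factorial_mul_factorial_cast {k l : ℕ} (h : k + l + 1 = p) :
    ((l)! : ZMod p) * ((k)! : ZMod p) = (-1) ^ (k + 1) := by
  induction k generalizing l with
  | zero =>
    have := ZMod.wilsons_lemma p
    rw [show p - 1 = l by omega] at this
    simp [this]
  | succ k ih =>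
    have h1 := ih (l := l + 1) (by omega)
    have h2 : ((l + 1 : ℕ) : ZMod p) = -((k + 1 : ℕ) : ZMod p) := by
      rw [eq_neg_iff_add_eq_zero, ← Nat.cast_add, show l + 1 + (k + 1) = p by omega,
        ZMod.natCast_self]
    rw [Nat.factorial_succ, Nat.cast_mul, h2] at h1
    rw [Nat.factorial_succ, Nat.cast_mul, pow_succ, ← h1]
    ring

variable (p) in
/-- The Legendre symbol of a natural number. -/
def natLegendre (j : ℕ) : ℤ := quadraticChar (ZMod p) j

theorem natLegendre_mul (a b : ℕ) : natLegendre p (a * b) = natLegendre p a * natLegendre p b := by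
  rw [natLegendre, Nat.cast_mul, map_mul]; rfl

theorem natLegendre_zero : natLegendre p 0 = 0 := by simp [natLegendre]

theorem natLegendre_one : natLegendre p 1 = 1 := by simp [natLegendre]

theorem natLegendre_dichotomy {j : ℕ} (hj : ¬ p ∣ j) :
    natLegendre p j = 1 ∨ natLegendre p j = -1 :=
  quadraticChar_dichotomy (by rwa [Ne, ZMod.natCast_eq_zero_iff])

theorem natLegendre_mul_self {j : ℕ} (hj : ¬ p ∣ j) :
    natLegendre p j * natLegendre p j = 1 := by
  rcases natLegendre_dichotomy hj with h | h <;> rw [h] <;> norm_num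

theorem not_dvd_factorial {j : ℕ} (hj : j < p) : ¬ p ∣ (j)! := by
  rw [(Fact.out : p.Prime).dvd_factorial]
  omega

theorem natLegendre_factorial (j : ℕ) :
    natLegendre p (j)! = ∏ i ∈ Finset.range j, natLegendre p (i + 1) := by
  induction j with
  | zero => simp [natLegendre_one]
  | succ j ih => rw [Finset.prod_range_succ, ← ih, Nat.factorial_succ, natLegendre_mul, mul_comm]

theorem quadraticChar_zmod_neg_one (hp : p % 4 = 3) : quadraticChar (ZMod p) (-1) = -1 :=
  quadraticChar_neg_one_of_card (by rwa [ZMod.card])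

theorem natLegendre_two_of_even {t : ℕ} (hp : p = 4 * (2 * t) + 3) : natLegendre p 2 = -1 := by
  rw [natLegendre, Nat.cast_two,
    quadraticChar_two (ringChar_ne_two_of_card (by rw [ZMod.card]; omega)), ZMod.card,
    ZMod.χ₈_nat_eq_if_mod_eight, if_neg (by omega), if_neg (by omega)]

theorem natLegendre_two_of_odd {t : ℕ} (hp : p = 4 * (2 * t + 1) + 3) : natLegendre p 2 = 1 := by
  rw [natLegendre, Nat.cast_two,
    quadraticChar_two (ringChar_ne_two_of_card (by rw [ZMod.card]; omega)), ZMod.card,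
    ZMod.χ₈_nat_eq_if_mod_eight, if_neg (by omega), if_pos (by omega)]

/-- A linear relation between the sums of the Legendre symbol over the first and second quarter. -/
theorem sum_natLegendre_quarters {m : ℕ} (hp : p = 4 * m + 3) :
    (∑ i ∈ Finset.range (m + 1), natLegendre p i) * (1 - natLegendre p 2) +
      (∑ i ∈ Finset.range (m + 1), natLegendre p (m + 1 + i)) * (1 + natLegendre p 2) = 0 := by
  have h1 := Finset.sum_range_add (natLegendre p) (m + 1) (m + 1)
  rw [← two_mul, sum_range_two_mul_eq, Finset.sum_add_distrib] at h1
  have h2 : ∑ i ∈ Finset.range (m + 1), natLegendre p (2 * i) =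
      natLegendre p 2 * ∑ i ∈ Finset.range (m + 1), natLegendre p i := by
    rw [Finset.mul_sum]
    exact Finset.sum_congr rfl fun i _ ↦ natLegendre_mul _ _
  -- The odd number 2i + 1 equals p - 2(2m + 1 - i), and 2m + 1 - i runs over the second quarter as
  -- i varies.
  have h3 : ∑ i ∈ Finset.range (m + 1), natLegendre p (2 * i + 1) =
      -(natLegendre p 2 * ∑ i ∈ Finset.range (m + 1), natLegendre p (m + 1 + i)) := by
    rw [← Finset.sum_range_reflect (fun i ↦ natLegendre p (m + 1 + i)), Finset.mul_sum,
      ← Finset.sum_neg_distrib]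
    refine Finset.sum_congr rfl fun i hi ↦ ?_
    rw [Finset.mem_range] at hi
    have h : ((2 * i + 1 : ℕ) : ZMod p) = -1 * ((2 * (m + 1 + (m + 1 - 1 - i)) : ℕ) : ZMod p) := by
      rw [neg_one_mul, eq_neg_iff_add_eq_zero, ← Nat.cast_add,
        show 2 * i + 1 + 2 * (m + 1 + (m + 1 - 1 - i)) = p by omega, ZMod.natCast_self]
    rw [← natLegendre_mul, natLegendre, h, map_mul, quadraticChar_zmod_neg_one (by omega),
      neg_one_mul]
    rfl
  rw [h2, h3] at h1
  linear_combination -h1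

/-- Here (2/p) = -1, so the first-quarter sum vanishes and exactly half of its 2t symbols are -1. -/
theorem natLegendre_factorial_quarter {t : ℕ} (hp : p = 4 * (2 * t) + 3) :
    natLegendre p (2 * t)! = (-1) ^ t := by
  have h := sum_natLegendre_quarters hp
  rw [natLegendre_two_of_even hp, Finset.sum_range_succ', natLegendre_zero] at h
  rw [natLegendre_factorial]
  refine prod_sign_eq_of_sum_eq_zero _ _ (fun i hi ↦ ?_) (by linarith) (Finset.card_range _)
  rw [Finset.mem_range] at hi
  exact natLegendre_dichotomy (Nat.not_dvd_of_pos_of_lt (by omega) (by omega))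

/-- Here (2/p) = 1, so the second-quarter sum vanishes. Up to squares the two factorials multiply to
the product of the 2t + 2 numbers in that quarter. -/
theorem natLegendre_factorial_mul_factorial_half {t : ℕ} (hp : p = 4 * (2 * t + 1) + 3) :
    natLegendre p (2 * t + 1)! * natLegendre p (2 * (2 * t + 1) + 1)! = (-1) ^ (t + 1) := by
  have h := sum_natLegendre_quarters hp
  rw [natLegendre_two_of_odd hp] at h
  have h1 : ∏ i ∈ Finset.range (2 * t + 1 + 1), natLegendre p (2 * t + 1 + 1 + i) =
      (-1) ^ (t + 1) := by
    refine prod_sign_eq_of_sum_eq_zero _ _ (fun i hi ↦ ?_) (by linarith)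
      ((Finset.card_range _).trans (by ring))
    rw [Finset.mem_range] at hi
    exact natLegendre_dichotomy (Nat.not_dvd_of_pos_of_lt (by omega) (by omega))
  rw [natLegendre_factorial (2 * (2 * t + 1) + 1),
    show 2 * (2 * t + 1) + 1 = (2 * t + 1) + (2 * t + 1 + 1) by ring, Finset.prod_range_add,
    ← natLegendre_factorial, ← mul_assoc,
    natLegendre_mul_self (not_dvd_factorial (by omega)), one_mul, ← h1]
  refine Finset.prod_congr rfl fun i _ ↦ ?_
  congr 1
  ring

/-- Modulo squares, (2j+1)!·(2j+2)! is 2(j+1). -/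
theorem prod_natLegendre_factorial {M : ℕ} (hM : 2 * M < p) :
    ∏ j ∈ Finset.range (2 * M + 1), natLegendre p (j)! =
      natLegendre p 2 ^ M * natLegendre p (M)! := by
  induction M with
  | zero => simp
  | succ M ih =>
    rw [mul_add, mul_one, Finset.prod_range_succ, Finset.prod_range_succ, ih (by omega),
      Nat.factorial_succ (2 * M + 1), natLegendre_mul, Nat.factorial_succ M, natLegendre_mul,
      show 2 * M + 1 + 1 = 2 * (M + 1) by ring, natLegendre_mul]
    have := natLegendre_mul_self (not_dvd_factorial (p := p) (j := 2 * M + 1) (by omega))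
    linear_combination (natLegendre p 2 ^ M * natLegendre p (M)! * natLegendre p 2 *
      natLegendre p (M + 1)) * this

theorem natLegendre_choose {n k : ℕ} (hp : p = 2 * n + 1) (hp4 : p % 4 = 3) (hk : k ≤ n) :
    natLegendre p ((2 * n - k).choose n) =
      (-1) ^ (k + 1) * natLegendre p (n)! * (natLegendre p (k)! * natLegendre p (n - k)!) := by
  have h1 := congrArg (natLegendre p)
    (Nat.choose_mul_factorial_mul_factorial (n := 2 * n - k) (k := n) (by omega))
  rw [natLegendre_mul, natLegendre_mul, show 2 * n - k - n = n - k by omega] at h1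
  have h2 : natLegendre p (2 * n - k)! * natLegendre p (k)! = (-1) ^ (k + 1) := by
    rw [natLegendre, natLegendre, ← map_mul, factorial_mul_factorial_cast (by omega), map_pow,
      quadraticChar_zmod_neg_one hp4]
  have ha := natLegendre_mul_self (not_dvd_factorial (p := p) (j := n) (by omega))
  have hb := natLegendre_mul_self (not_dvd_factorial (p := p) (j := k) (by omega))
  have hc := natLegendre_mul_self (not_dvd_factorial (p := p) (j := n - k) (by omega))
  rw [← h2, ← h1]
  generalize natLegendre p ((2 * n - k).choose n) = x at *
  generalize natLegendre p (n)! = a at *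
  generalize natLegendre p (k)! = b at *
  generalize natLegendre p (n - k)! = c at *
  calc x = x * 1 * 1 * 1 := by ring
    _ = x * (a * a) * (b * b) * (c * c) := by rw [ha, hb, hc]
    _ = _ := by ring

/-- With n = 2m + 1, the factorials k! and (n-k)! for 1 ≤ k ≤ m are exactly 1!, …, (2m)!, each once.
-/
theorem prod_natLegendre_choose {m : ℕ} (hp : p = 4 * m + 3) :
    ∏ i ∈ Finset.range m, natLegendre p ((2 * (2 * m + 1) - (i + 1)).choose (2 * m + 1)) =
      (∏ i ∈ Finset.range m, (-1) ^ i) * natLegendre p (2 * m + 1)! ^ m *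
        (natLegendre p 2 ^ m * natLegendre p (m)!) := by
  have h1 : ∀ i ∈ Finset.range m,
      natLegendre p ((2 * (2 * m + 1) - (i + 1)).choose (2 * m + 1)) =
        (-1) ^ i * natLegendre p (2 * m + 1)! *
          (natLegendre p (i + 1)! * natLegendre p (m + 1 + (m - 1 - i))!) := by
    intro i hi
    rw [Finset.mem_range] at hi
    rw [natLegendre_choose (by omega) (by omega) (by omega),
      show 2 * m + 1 - (i + 1) = m + 1 + (m - 1 - i) by omega]
    ring
  rw [Finset.prod_congr rfl h1, Finset.prod_mul_distrib, Finset.prod_mul_distrib,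
    Finset.prod_mul_distrib, Finset.prod_const, Finset.card_range,
    Finset.prod_range_reflect (fun i ↦ natLegendre p (m + 1 + i)!),
    ← prod_natLegendre_factorial (by omega : 2 * m < p),
    show 2 * m + 1 = m + 1 + m by ring, Finset.prod_range_add, Finset.prod_range_succ']
  simp [natLegendre_one]

theorem quadraticChar_neg_two_mul_prod_choose {m : ℕ} (hp : p = 4 * m + 3) :
    quadraticChar (ZMod p) (-2 * ∏ k ∈ Finset.Icc 1 m,
      ((2 * (2 * m + 1) - k).choose (2 * m + 1) : ZMod p)) = 1 := by
  have h1 : ∏ k ∈ Finset.Icc 1 m, ((2 * (2 * m + 1) - k).choose (2 * m + 1) : ZMod p) =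
      ∏ i ∈ Finset.range m, ((2 * (2 * m + 1) - (i + 1)).choose (2 * m + 1) : ZMod p) := by
    rw [Finset.range_eq_Ico, Finset.prod_Ico_add'
      (fun k ↦ ((2 * (2 * m + 1) - k).choose (2 * m + 1) : ZMod p)) 0 m 1]
    rfl
  have h2 : (-2 : ZMod p) = -1 * (2 : ℕ) := by norm_num
  rw [h1, h2, map_mul, map_mul, quadraticChar_zmod_neg_one (by omega), map_prod]
  change -1 * natLegendre p 2 * ∏ i ∈ Finset.range m,
    natLegendre p ((2 * (2 * m + 1) - (i + 1)).choose (2 * m + 1)) = 1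
  rw [prod_natLegendre_choose hp]
  have hn := natLegendre_mul_self (not_dvd_factorial (p := p) (j := 2 * m + 1) (by omega))
  have hs : ∀ t, ((-1 : ℤ) ^ t) * (-1) ^ t = 1 := fun t ↦ by
    rw [← mul_pow]; norm_num
  -- For even m the power of (n!/p) disappears and only m! remains; for odd m one factor (n!/p)
  -- survives, and just the product with (m!/p) is known.
  rcases Nat.even_or_odd' m with ⟨t, rfl | rfl⟩
  · rw [natLegendre_two_of_even hp, natLegendre_factorial_quarter hp,
      prod_neg_one_pow_range_two_mul, pow_mul, sq, hn, one_pow, pow_mul, neg_one_sq, one_pow]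
    linear_combination hs t
  · have h3 := natLegendre_factorial_mul_factorial_half hp
    have h4 : natLegendre p (2 * (2 * t + 1) + 1)! ^ (2 * t + 1) =
        natLegendre p (2 * (2 * t + 1) + 1)! := by
      rw [pow_succ, pow_mul, sq, hn, one_pow, one_mul]
    rw [natLegendre_two_of_odd hp, Finset.prod_range_succ, prod_neg_one_pow_range_two_mul,
      one_pow, h4, pow_mul (-1 : ℤ) 2 t, neg_one_sq, one_pow]
    rw [pow_succ] at h3
    linear_combination hs t - (-1) ^ t * h3

end Legendre

/-! ### The integer r and its sign -/

section Main

theorem jacobiProduct_eq_prod_jacobiPair {F : Type*} [Field F] [Fintype F] [DecidableEq F]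
    {K : Type*} [Field K] {m : ℕ} (hF : Fintype.card F = 2 * (2 * m + 1) + 1) (χ : MulChar F K) :
    jacobiProduct χ = ∏ k ∈ Finset.Icc 1 m, jacobiPair (χ ^ k) := by
  refine Finset.prod_congr ?_ fun k _ ↦ rfl
  ext k
  -- The bound 4k < q - 1 = 4m + 2 means k ≤ m.
  rw [Finset.mem_filter, Finset.mem_range, Finset.mem_Icc, hF]
  omega

/-- A generator of the group of characters takes a primitive root of unity as value at a generator
of the group of units. -/
theorem isPrimitiveRoot_apply_of_generator {F : Type*} [Field F] [Fintype F]
    {K : Type*} [Field K] {N : ℕ} (hN : 0 < N) (hF : Fintype.card F = N + 1) {g : Fˣ}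
    (hg : ∀ x, x ∈ Subgroup.zpowers g) {ζ : K} (hζ : IsPrimitiveRoot ζ N) {χ : MulChar F K}
    (hχ : ∀ ψ : MulChar F K, ψ ∈ Subgroup.zpowers χ) : IsPrimitiveRoot (χ g) N := by
  obtain ⟨ψ, hψ⟩ := exists_mulChar_apply_generator hN hF hg hζ.pow_eq_one
  have h1 : ψ ^ N = 1 := pow_eq_one_of_apply_generator hg (hψ ▸ hζ.pow_eq_one)
  refine ⟨?_, fun l hl ↦ ?_⟩
  · rw [← map_pow, (isPrimitiveRoot_of_generator hF hg).pow_eq_one, map_one]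
  -- The character sending g to ζ is a power of χ, so χ(g)^l = 1 forces ζ^l = 1.
  · obtain ⟨j, rfl⟩ := Subgroup.mem_zpowers_iff.1 (hχ ψ)
    have h2 : χ ^ l = 1 := pow_eq_one_of_apply_generator hg hl
    refine hζ.dvd_of_pow_eq_one l ?_
    rw [← hψ, ← MulChar.pow_apply_coe, ← zpow_natCast, ← zpow_mul, mul_comm, zpow_mul,
      zpow_natCast, h2, one_zpow, MulChar.one_apply_coe]

theorem exists_int_jacobiProduct {p m : ℕ} [Fact p.Prime] (hp : p = 4 * m + 3)
    (K : Type*) [Field K] [IsAlgClosed K] [CharZero K] :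
    ∃ r : ℤ, r ^ 2 = -(2 ^ (2 * m) * (squareSumMatrix (ZMod p)).det) ∧
      legendreSym p (-2 * r) = 1 ∧
      ∀ χ : MulChar (ZMod p) K, (∀ ψ : MulChar (ZMod p) K, ψ ∈ Subgroup.zpowers χ) →
        jacobiProduct χ = r := by
  have hF : Fintype.card (ZMod p) = 2 * (2 * m + 1) + 1 := by rw [ZMod.card]; omega
  have hN0 : 0 < 2 * (2 * m + 1) := by omega
  obtain ⟨g, hg⟩ := IsCyclic.exists_generator (α := (ZMod p)ˣ)
  let ι : MulChar (ZMod p) (ZMod p) := MulChar.ofUnitHom (MonoidHom.id _)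
  have hι : ∀ x, ι x = x := by
    intro x
    rcases eq_or_ne x 0 with rfl | hx
    · exact MulChar.map_zero ι
    · exact MulChar.ofUnitHom_coe _ (Units.mk0 x hx)
  obtain ⟨r, hr, hr'⟩ := exists_int_prod_jacobiPair rfl hF hg K (hι g)
  have : NeZero ((2 * (2 * m + 1) : ℕ) : K) := ⟨by exact_mod_cast hN0.ne'⟩
  obtain ⟨ζ, hζ⟩ := HasEnoughRootsOfUnity.exists_primitiveRoot K (2 * (2 * m + 1))
  obtain ⟨ψ, hψ⟩ := exists_mulChar_apply_generator hN0 hF hg hζ.pow_eq_one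
  refine ⟨r, ?_, ?_, fun χ hχ ↦ ?_⟩
  · have h := sq_prod_jacobiPair_generator hF hg (hψ.symm ▸ hζ)
    rw [hr ψ (hψ.symm ▸ hζ)] at h
    exact_mod_cast h
  · have h : ∀ k ∈ Finset.Icc 1 m, jacobiPair (ι ^ k) =
        ((2 * (2 * m + 1) - k).choose (2 * m + 1) : ZMod p) := by
      intro k hk
      rw [Finset.mem_Icc] at hk
      exact jacobiPair_pow_tautological (odd_two_mul_add_one m) hF hι (by omega) (by omega)
    rw [Finset.prod_congr rfl h] at hr'
    rw [legendreSym]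
    push_cast
    rw [hr']
    exact quadraticChar_neg_two_mul_prod_choose hp
  · rw [jacobiProduct_eq_prod_jacobiPair hF]
    exact hr χ (isPrimitiveRoot_apply_of_generator hN0 hF hg hζ hχ)

/-- `w` is the value of the square root, which is an integer, so that its Legendre symbol makes
sense; `δ` is the sign singled out by the Legendre symbol condition. -/
theorem corollary1p1 (p n : ℕ) [Fact p.Prime] (hpn : p = 2 * n + 1) (hp : p % 4 = 3)
    {K : Type*} [Field K] [IsAlgClosed K] [CharZero K] :
    0 ≤ -(2 ^ (n - 1) * (squareSumMatrix (ZMod p)).det) ∧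
    ∃ w : ℕ,
      (w : ℝ) = √(-(2 ^ (n - 1) * ((squareSumMatrix (ZMod p)).det : ℝ))) ∧
      (∃! δ : ℤ, (δ = 1 ∨ δ = -1) ∧ legendreSym p (-2 * δ * w) = 1) ∧
      ∀ δ : ℤ, (δ = 1 ∨ δ = -1) → legendreSym p (-2 * δ * w) = 1 →
        ∀ χ : MulChar (ZMod p) K, (∀ ψ : MulChar (ZMod p) K, ψ ∈ Subgroup.zpowers χ) →
          jacobiProduct χ = ((δ * w : ℤ) : K) := by
  obtain ⟨m, rfl⟩ : ∃ m, n = 2 * m + 1 := ⟨n / 2, by omega⟩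
  obtain ⟨r, hsq, hleg, hχ⟩ := exists_int_jacobiProduct (p := p) (m := m) (by omega) K
  rw [Nat.add_sub_cancel]
  have hneg : ∀ a : ℤ, legendreSym p (-a) = -legendreSym p a := by
    intro a
    rw [legendreSym, legendreSym, Int.cast_neg, ← neg_one_mul, map_mul,
      quadraticChar_zmod_neg_one hp, neg_one_mul]
  obtain ⟨ε, hε, hrε⟩ : ∃ ε : ℤ, (ε = 1 ∨ ε = -1) ∧ r = ε * r.natAbs := by
    rcases Int.natAbs_eq r with h | h
    · exact ⟨1, Or.inl rfl, by rwa [one_mul]⟩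
    · exact ⟨-1, Or.inr rfl, by rwa [neg_one_mul]⟩
  have hεleg : legendreSym p (-2 * ε * r.natAbs) = 1 := by rw [mul_assoc, ← hrε, hleg]
  -- Flipping the sign flips the symbol, since (-1/p) = -1, so only the sign of r can qualify.
  have huniq : ∀ δ : ℤ, (δ = 1 ∨ δ = -1) → legendreSym p (-2 * δ * r.natAbs) = 1 → δ = ε := by
    intro δ hδ h
    by_contra hne
    have hδε : δ = -ε := by omega
    rw [hδε, mul_neg, neg_mul, hneg, hεleg] at h
    norm_num at h
  refine ⟨hsq ▸ sq_nonneg r, r.natAbs, ?_, ⟨ε, ⟨hε, hεleg⟩, fun δ h ↦ huniq δ h.1 h.2⟩, ?_⟩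
  · have h : -(2 ^ (2 * m) * ((squareSumMatrix (ZMod p)).det : ℝ)) = (r : ℝ) ^ 2 := by
      exact_mod_cast hsq.symm
    rw [h, Real.sqrt_sq_eq_abs, Nat.cast_natAbs, Int.cast_abs]
  · intro δ hδ h χ hgen
    rw [huniq δ hδ h, ← hrε, hχ χ hgen]

end Main
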